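/- For a finite simple graph $\mathcal{G}$ with vertex set $v(\mathcal G)$ and edge set $e(\mathcal G)$, let $A$ be its adjacency matrix, $D$ its degree matrix, $L=D-A$ its Laplacian matrix and $Q=D+A$ its signless Laplacian matrix. Define \[ E(\mathcal G)=\sum_{\lambda}|\lambda|,\qquad LE(\mathcal G)=\sum_{\mu}\left|\mu-\frac{2|e(\mathcal G)|}{|v(\mathcal G)|}\right|,\qquad LE^+(\mathcal G)=\sum_{\nu}\left|\nu-\frac{2|e(\mathcal G)|}{|v(\mathcal G)|}\right|, \] where $\lambda,\mu,\nu$ run over the eigenvalues of $A$, $L$, $Q$ respectively, counted with multiplicity. For a finite non-abelian group $G$ with center $Z(G)$, the commuting graph $\Gamma_G$ is the simple graph with vertex set $G\setminus Z(G)$ in which two distinct vertices $x,y$ are adjacent if and only if $xy=yx$. **Proposition.** Let $k\ge 2$ and let $G=PSL(2,2^k)$ be the projective special linear group of degree $2$ over the field with $2^k$ elements. Then \[ E(\Gamma_G)=2^{3k+1}-2^{2k+1}-2^{k+2}-4, \] \[ LE(\Gamma_G)=\frac{2\cdot 2^{6k}-2\cdot 2^{5k}-3\cdot 2^{4k}-4\cdot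 2^{3k}+3\cdot 2^{2k}+8\cdot 2^{k}+4}{2^{3k}-2^k-1}, \] and \[ LE^+(\Gamma_G)=\begin{cases} \dfrac{2^{6k}+2^{5k}-3\cdot 2^{4k}-7\cdot 2^{3k}+4\cdot 2^k+4}{2^{3k}-2^k-1}, & \text{if } k=2,\\[2ex] \dfrac{2\cdot 2^{6k}-2\cdot 2^{5k}-8\cdot 2^{4k}-6\cdot 2^{3k}+6\cdot 2^{2k}+8\cdot 2^k+4}{2^{3k}-2^k-1}, & \text{if } k\ge 3. \end{cases} \] -/

import Mathlib

namespace SimpleGraph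

/-- The spectrum of a finite graph: the multiset of eigenvalues of the adjacency matrix, with
multiplicity. The matrix is real symmetric, so all roots of its characteristic polynomial are real
and their multiplicities are the dimensions of the eigenspaces. -/
noncomputable def adjSpec {V : Type*} [Fintype V] [DecidableEq V] (G : SimpleGraph V)
    [DecidableRel G.Adj] : Multiset ℝ :=
  (G.adjMatrix ℝ).charpoly.roots

/-- The Laplacian spectrum of a finite graph (with multiplicity). -/
noncomputable def lapSpec {V : Type*} [Fintype V] [DecidableEq V] (G : SimpleGraph V)
    [DecidableRel G.Adj] : Multiset ℝ :=
  (G.lapMatrix ℝ).charpoly.roots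

/-- The signless Laplacian matrix `D + A`. -/
def signlessLapMatrix {V : Type*} [Fintype V] [DecidableEq V] (R : Type*) [AddMonoidWithOne R]
    (G : SimpleGraph V) [DecidableRel G.Adj] : Matrix V V R :=
  G.degMatrix R + G.adjMatrix R

/-- The signless Laplacian spectrum of a finite graph (with multiplicity). -/
noncomputable def signlessLapSpec {V : Type*} [Fintype V] [DecidableEq V] (G : SimpleGraph V)
    [DecidableRel G.Adj] : Multiset ℝ :=
  (G.signlessLapMatrix ℝ).charpoly.roots

/-- The average degree `2|e(G)| / |v(G)|`. -/
noncomputable def averageDeg {V : Type*} [Fintype V] [DecidableEq V] (G : SimpleGraph V)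
    [DecidableRel G.Adj] : ℝ :=
  2 * (G.edgeFinset.card : ℝ) / (Fintype.card V : ℝ)

/-- The energy of a finite graph. -/
noncomputable def energy {V : Type*} [Fintype V] [DecidableEq V] (G : SimpleGraph V)
    [DecidableRel G.Adj] : ℝ :=
  (G.adjSpec.map fun l => |l|).sum

/-- The Laplacian energy of a finite graph. -/
noncomputable def lapEnergy {V : Type*} [Fintype V] [DecidableEq V] (G : SimpleGraph V)
    [DecidableRel G.Adj] : ℝ :=
  (G.lapSpec.map fun m => |m - G.averageDeg|).sum

/-- The signless Laplacian energy of a finite graph. -/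
noncomputable def signlessLapEnergy {V : Type*} [Fintype V] [DecidableEq V] (G : SimpleGraph V)
    [DecidableRel G.Adj] : ℝ :=
  (G.signlessLapSpec.map fun n => |n - G.averageDeg|).sum

end SimpleGraph

/-- The set `G \ Z(G)` of non-central elements of a group, as a type. -/
abbrev NonCentral (G : Type*) [Group G] : Type _ :=
  {x : G // x ∉ Subgroup.center G}

/-- The commuting graph of a group: the vertices are the non-central elements, and two distinct
vertices are adjacent iff they commute. -/
def commutingGraph (G : Type*) [Group G] : SimpleGraph (NonCentral G) where
  Adj x y := x ≠ y ∧ (x : G) * (y : G) = (y : G) * (x : G)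
  symm := ⟨fun _ _ h => ⟨h.1.symm, h.2.symm⟩⟩
  loopless := ⟨fun _ h => h.1 rfl⟩

/-! ### Spectra of matrices that are scalar plus constant on blocks. -/

namespace Matrix

open Polynomial

/-! Let q = |F|. In characteristic 2 the only scalar matrix of determinant 1 is the identity, so
PSL(2,F) = SL(2,F) has trivial center. A matrix commuting with a non-scalar 2×2 matrix g has the
form x + yg; hence commuting is transitive on non-identity elements and the commuting graph is a
disjoint union of cliques. Its three matrices are then block diagonal with blocks aI + cJ (J all
ones), so each energy is a sum over vertices of a function of the degree
(`Matrix.sum_map_roots_charpoly_of_fibers`).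

The degrees depend only on the trace t, through the number r(t) of roots of X² + tX + 1. The
centralizer of g ≠ 1 is the conic det(x + yg) = x² + txy + y² = 1, with q + 1 - r(t) points, so the
degree is q - 1 - r(t); and q(q-1) + r(t)q elements have trace t. Since r(0) = 1, the other r(t) are
0 or 2, and all sum to q - 1, the values 1, 0, 2 occur for 1, q/2 and (q-2)/2 traces. This gives the
degree distribution (`sum_comp_degree_commutingGraph_of_mulEquiv`). -/

theorem charpoly_scalar_add_const {n : Type*} [Fintype n] [DecidableEq n] [Nonempty n]
    (a c : ℝ) :
    (of fun i j : n => (if i = j then a else 0) + c).charpoly =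
      (X - C (a + Fintype.card n * c)) * (X - C a) ^ (Fintype.card n - 1) := by
  have h1 : (of fun i j : n => (if i = j then a else 0) + c) =
      vecMulVec (fun _ : n => c) (fun _ => 1) - scalar n (-a) := by
    ext i j
    simp only [of_apply, sub_apply, vecMulVec_apply, scalar_apply, diagonal_apply, mul_one]
    split_ifs <;> ring
  obtain ⟨m, hm⟩ : ∃ m, Fintype.card n = m + 1 :=
    Nat.exists_eq_succ_of_ne_zero Fintype.card_ne_zero
  rw [h1, charpoly_sub_scalar, charpoly_vecMulVec, hm]
  simp only [dotProduct, mul_one, Finset.sum_const, Finset.card_univ, hm, Nat.add_sub_cancel,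
    smul_eq_C_mul, nsmul_eq_mul, sub_comp, mul_comp, pow_comp, X_comp, C_comp, pow_succ]
  push_cast
  simp only [C_add, C_mul, C_neg, C_1]
  ring

/-- A fiber of size m contributes a + mc once and a with multiplicity m - 1. Dividing that
contribution by m spreads it evenly over the fiber, so the sum runs over vertices and can later be
regrouped by degree. -/
theorem sum_map_roots_charpoly_of_fibers {V α : Type*} [Fintype V] [DecidableEq V]
    [LinearOrder α] (b : V → α) (M : Matrix V V ℝ) (a : α → ℝ) (c : ℝ)
    (hM : ∀ v w, M v w = if b v = b w then (if v = w then a (b v) else 0) + c else 0)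
    (f : ℝ → ℝ) :
    (M.charpoly.roots.map f).sum =
      ∑ v, (f (a (b v) + Fintype.card {w // b w = b v} * c) +
        ((Fintype.card {w // b w = b v} : ℝ) - 1) * f (a (b v))) /
          Fintype.card {w // b w = b v} := by
  have htri : M.BlockTriangular b := by
    intro v w hvw
    rw [hM, if_neg hvw.ne']
  have hblock : ∀ k ∈ Finset.univ.image b, (M.toSquareBlock b k).charpoly =
      (X - C (a k + Fintype.card {w // b w = k} * c)) *
        (X - C (a k)) ^ (Fintype.card {w // b w = k} - 1) := by
    intro k hk
    obtain ⟨v, -, rfl⟩ := Finset.mem_image.mp hk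
    have : Nonempty {w // b w = b v} := ⟨⟨v, rfl⟩⟩
    rw [← charpoly_scalar_add_const]
    congr 1
    ext ⟨i, hi⟩ ⟨j, hj⟩
    simp [toSquareBlock_def, hM, hi, hj]
  rw [htri.charpoly, Finset.prod_congr rfl hblock, roots_prod]
  · rw [Multiset.map_bind, Multiset.sum_bind]
    have hfib := Finset.sum_fiberwise_of_maps_to (s := Finset.univ) (t := Finset.univ.image b)
      (g := b) (fun v _ => Finset.mem_image_of_mem b (Finset.mem_univ v))
      (fun v => (f (a (b v) + Fintype.card {w // b w = b v} * c) +
        ((Fintype.card {w // b w = b v} : ℝ) - 1) * f (a (b v))) /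
          Fintype.card {w // b w = b v})
    rw [← hfib]
    refine Finset.sum_congr rfl fun k hk => ?_
    have hpos : 0 < Fintype.card {w // b w = k} := by
      obtain ⟨v, -, rfl⟩ := Finset.mem_image.mp hk
      exact Fintype.card_pos_iff.mpr ⟨⟨v, rfl⟩⟩
    have hconst : ∑ v with b v = k, (f (a (b v) + Fintype.card {w // b w = b v} * c) +
        ((Fintype.card {w // b w = b v} : ℝ) - 1) * f (a (b v))) /
          Fintype.card {w // b w = b v} =
        ∑ v with b v = k, (f (a k + Fintype.card {w // b w = k} * c) +
        ((Fintype.card {w // b w = k} : ℝ) - 1) * f (a k)) /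
          Fintype.card {w // b w = k} := by
      refine Finset.sum_congr rfl fun v hv => ?_
      obtain rfl := (Finset.mem_filter.mp hv).2
      rfl
    rw [hconst, Finset.sum_const, ← Fintype.card_subtype, nsmul_eq_mul,
      mul_div_cancel₀ _ (by positivity), roots_mul
        (mul_ne_zero (X_sub_C_ne_zero _) (pow_ne_zero _ (X_sub_C_ne_zero _)))]
    rw [roots_X_sub_C, Polynomial.roots_pow, roots_X_sub_C, Multiset.map_add, Multiset.sum_add,
      Multiset.map_nsmul, Multiset.sum_nsmul]
    simp [Nat.cast_sub (Nat.one_le_iff_ne_zero.mpr hpos.ne')]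
  · exact Finset.prod_ne_zero_iff.mpr fun k _ =>
      mul_ne_zero (X_sub_C_ne_zero _) (pow_ne_zero _ (X_sub_C_ne_zero _))

end Matrix

/-! ### Energies of disjoint unions of cliques. -/

namespace SimpleGraph

/-- Each clique is labelled by the index of a chosen representative; `Fin` supplies the linear order
that block triangularity requires. -/
theorem exists_fin_labelling_of_adj_trans {V : Type*} [Fintype V] (G : SimpleGraph V)
    (h : ∀ u v w, G.Adj u v → G.Adj v w → u ≠ w → G.Adj u w) :
    ∃ b : V → Fin (Fintype.card V), ∀ v w, G.Adj v w ↔ v ≠ w ∧ b v = b w := by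
  let s : Setoid V :=
    { r := fun v w => v = w ∨ G.Adj v w
      iseqv :=
        { refl := fun v => Or.inl rfl
          symm := by
            rintro v w (rfl | hvw)
            · exact Or.inl rfl
            · exact Or.inr hvw.symm
          trans := by
            rintro u v w (rfl | huv) (rfl | hvw)
            · exact Or.inl rfl
            · exact Or.inr hvw
            · exact Or.inr huv
            · by_cases huw : u = w
              · exact Or.inl huw
              · exact Or.inr (h u v w huv hvw huw) } }
  refine ⟨fun v => Fintype.equivFin V (Quotient.out (Quotient.mk s v)), fun v w => ?_⟩
  rw [(Fintype.equivFin V).injective.eq_iff, Quotient.out_inj, Quotient.eq]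
  change G.Adj v w ↔ v ≠ w ∧ (v = w ∨ G.Adj v w)
  constructor
  · exact fun hvw => ⟨hvw.ne, Or.inr hvw⟩
  · rintro ⟨h1, h2 | h2⟩
    · exact absurd h2 h1
    · exact h2

section DisjointCliques

variable {V : Type*} [Fintype V] [DecidableEq V] (G : SimpleGraph V) [DecidableRel G.Adj]

theorem card_fiber_eq_degree_add_one {α : Type*} [DecidableEq α] (b : V → α)
    (hb : ∀ v w, G.Adj v w ↔ v ≠ w ∧ b v = b w) (v : V) :
    Fintype.card {w // b w = b v} = G.degree v + 1 := by
  rw [Fintype.card_subtype, ← card_neighborFinset_eq_degree,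
    ← Finset.card_insert_of_notMem (G.notMem_neighborFinset_self v)]
  congr 1
  ext w
  simp only [Finset.mem_filter, Finset.mem_univ, true_and, Finset.mem_insert,
    mem_neighborFinset, hb]
  grind

variable {G}

theorem energy_eq_sum_of_adj_trans
    (h : ∀ u v w, G.Adj u v → G.Adj v w → u ≠ w → G.Adj u w) :
    G.energy = ∑ v, 2 * (G.degree v : ℝ) / (G.degree v + 1) := by
  obtain ⟨b, hb⟩ := G.exists_fin_labelling_of_adj_trans h
  rw [energy, adjSpec, Matrix.sum_map_roots_charpoly_of_fibers b _ (fun _ => -1) 1]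
  · refine Finset.sum_congr rfl fun v _ => ?_
    rw [G.card_fiber_eq_degree_add_one b hb]
    push_cast
    have : |(-1 : ℝ) + ((G.degree v : ℝ) + 1) * 1| = G.degree v := by
      rw [abs_of_nonneg] <;> ring_nf
      positivity
    rw [this, abs_neg, abs_one]
    ring
  · intro v w
    simp only [adjMatrix_apply, hb]
    split_ifs <;> grind

theorem lapEnergy_eq_sum_of_adj_trans
    (h : ∀ u v w, G.Adj u v → G.Adj v w → u ≠ w → G.Adj u w) :
    G.lapEnergy = ∑ v, (|G.averageDeg| + G.degree v * |G.degree v + 1 - G.averageDeg|) /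
      ((G.degree v : ℝ) + 1) := by
  obtain ⟨b, hb⟩ := G.exists_fin_labelling_of_adj_trans h
  rw [lapEnergy, lapSpec, Matrix.sum_map_roots_charpoly_of_fibers b _
    (fun k => Fintype.card {w // b w = k}) (-1)]
  · refine Finset.sum_congr rfl fun v _ => ?_
    rw [G.card_fiber_eq_degree_add_one b hb]
    push_cast
    rw [show ((G.degree v : ℝ) + 1 + (G.degree v + 1) * -1 - G.averageDeg) = -G.averageDeg by ring,
      abs_neg]
    ring
  · intro v w
    rw [G.card_fiber_eq_degree_add_one b hb]
    simp only [lapMatrix, degMatrix, Matrix.sub_apply, Matrix.diagonal_apply, adjMatrix_apply, hb]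
    push_cast
    split_ifs <;> grind

theorem signlessLapEnergy_eq_sum_of_adj_trans
    (h : ∀ u v w, G.Adj u v → G.Adj v w → u ≠ w → G.Adj u w) :
    G.signlessLapEnergy =
      ∑ v, (|2 * G.degree v - G.averageDeg| + G.degree v * |G.degree v - 1 - G.averageDeg|) /
        ((G.degree v : ℝ) + 1) := by
  obtain ⟨b, hb⟩ := G.exists_fin_labelling_of_adj_trans h
  rw [signlessLapEnergy, signlessLapSpec, Matrix.sum_map_roots_charpoly_of_fibers b _
    (fun k => (Fintype.card {w // b w = k} : ℝ) - 2) 1]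
  · refine Finset.sum_congr rfl fun v _ => ?_
    rw [G.card_fiber_eq_degree_add_one b hb]
    push_cast
    ring_nf
  · intro v w
    rw [G.card_fiber_eq_degree_add_one b hb]
    simp only [signlessLapMatrix, degMatrix, Matrix.add_apply, Matrix.diagonal_apply,
      adjMatrix_apply, hb]
    push_cast
    split_ifs <;> grind

theorem averageDeg_eq_sum_div : G.averageDeg = (∑ v, (G.degree v : ℝ)) / Fintype.card V := by
  rw [averageDeg]
  congr 1
  exact_mod_cast G.sum_degrees_eq_twice_card_edges.symm

end DisjointCliques

end SimpleGraph

/-! ### The form x² + txy + y² in characteristic 2. -/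

section CharTwo

variable {F : Type*} [Field F]

/-- The roots of `X² + tX + 1`. -/
abbrev QuadRoots (t : F) : Type _ := {a : F // a ^ 2 + t * a + 1 = 0}

/-- The solutions of `x² + txy + y² = 1`. -/
abbrev QuadConic (t : F) : Type _ := {p : F × F // p.1 ^ 2 + t * p.1 * p.2 + p.2 ^ 2 = 1}

/-- Squaring is bijective on F, so a vector where the form is nonzero is a unique unit multiple of a
point of the conic. A nonzero vector (x, y) where it vanishes has y ≠ 0 and x/y a root. Hence q² = 1
+ (q - 1)(conic points + roots). -/
theorem card_quadConic_add_card_quadRoots [Finite F] [CharP F 2] (t : F) :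
    Nat.card (QuadConic t) + Nat.card (QuadRoots t) = Nat.card F + 1 := by
  let f : Option (Fˣ × (QuadConic t ⊕ QuadRoots t)) → F × F
    | none => (0, 0)
    | some (u, Sum.inl p) => (u * p.1.1, u * p.1.2)
    | some (u, Sum.inr a) => (u * a.1, u)
  have hval : ∀ (u : Fˣ) (p : QuadConic t),
      (u * p.1.1) ^ 2 + t * (u * p.1.1) * (u * p.1.2) + (u * p.1.2) ^ 2 = (u : F) ^ 2 := by
    intro u p
    linear_combination (u : F) ^ 2 * p.2
  have hval0 : ∀ (u : Fˣ) (a : QuadRoots t),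
      (u * a.1) ^ 2 + t * (u * a.1) * u + (u : F) ^ 2 = 0 := by
    intro u a
    linear_combination (u : F) ^ 2 * a.2
  have hsq : ∀ x y : F, x ^ 2 = y ^ 2 → x = y := fun x y h => by
    have := frobenius_inj F 2
    exact this (by simpa [frobenius_def] using h)
  have hinj : Function.Injective f := by
    rintro (_ | ⟨u, p | a⟩) (_ | ⟨v, p' | a'⟩) h
    · rfl
    · have h1 := hval v p'
      simp only [f, Prod.mk.injEq] at h
      rw [← h.1, ← h.2] at h1
      exact absurd h1.symm (by simp)
    · simp only [f, Prod.mk.injEq] at h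
      exact absurd h.2.symm v.ne_zero
    · have h1 := hval u p
      simp only [f, Prod.mk.injEq] at h
      rw [h.1, h.2] at h1
      exact absurd h1.symm (by simp)
    · have h1 := hval u p
      have h2 := hval v p'
      simp only [f, Prod.mk.injEq] at h
      rw [h.1, h.2, h2] at h1
      obtain rfl : v = u := Units.ext (hsq _ _ h1)
      obtain ⟨h3, h4⟩ := h
      obtain rfl : p = p' :=
        Subtype.ext (Prod.ext (mul_left_cancel₀ v.ne_zero h3) (mul_left_cancel₀ v.ne_zero h4))
      rfl
    · have h1 := hval u p
      simp only [f, Prod.mk.injEq] at h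
      rw [h.1, h.2, hval0 v a'] at h1
      exact absurd h1.symm (by simp)
    · simp only [f, Prod.mk.injEq] at h
      exact absurd h.2 u.ne_zero
    · have h1 := hval v p'
      simp only [f, Prod.mk.injEq] at h
      rw [← h.1, ← h.2, hval0 u a] at h1
      exact absurd h1.symm (by simp)
    · simp only [f, Prod.mk.injEq] at h
      obtain rfl : u = v := Units.ext h.2
      obtain rfl : a = a' := Subtype.ext (mul_left_cancel₀ u.ne_zero h.1)
      rfl
  have hsurj : Function.Surjective f := by
    rintro ⟨x, y⟩
    by_cases hQ : x ^ 2 + t * x * y + y ^ 2 = 0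
    · by_cases hy : y = 0
      · subst hy
        refine ⟨none, ?_⟩
        obtain rfl : x = 0 := by simpa using hQ
        rfl
      · refine ⟨some (Units.mk0 y hy, Sum.inr ⟨x / y, ?_⟩), ?_⟩
        · field_simp
          linear_combination hQ
        · simp only [f, Units.val_mk0, Prod.mk.injEq, and_true]
          field_simp
    · obtain ⟨s, hs⟩ := surjective_frobenius F 2 (x ^ 2 + t * x * y + y ^ 2)
      rw [frobenius_def] at hs
      have hs0 : s ≠ 0 := by
        rintro rfl
        exact hQ (by simpa using hs.symm)
      refine ⟨some (Units.mk0 s hs0, Sum.inl ⟨(x / s, y / s), ?_⟩), ?_⟩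
      · field_simp
        linear_combination -hs
      · simp only [f, Units.val_mk0, Prod.mk.injEq]
        constructor <;> field_simp
  have hcard := Nat.card_eq_of_bijective f ⟨hinj, hsurj⟩
  rw [Finite.card_option, Nat.card_prod, Nat.card_sum, Nat.card_prod, Nat.card_units] at hcard
  obtain ⟨m, hm⟩ : ∃ m, Nat.card F = m + 2 :=
    ⟨Nat.card F - 2, by have := Finite.one_lt_card (α := F); omega⟩
  rw [hm] at hcard ⊢
  simp only [show m + 2 - 1 = m + 1 by omega] at hcard
  have : (m + 1) * (Nat.card (QuadConic t) + Nat.card (QuadRoots t)) = (m + 1) * (m + 2 + 1) := by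
    linarith
  exact Nat.eq_of_mul_eq_mul_left (Nat.succ_pos m) this

/-- Every nonzero a is a root for exactly one t, namely -(a² + 1)/a, and 0 is never a root. -/
theorem sum_card_quadRoots [Fintype F] :
    ∑ t : F, Nat.card (QuadRoots t) = Nat.card F - 1 := by
  rw [← Nat.card_units, ← Nat.card_sigma]
  have hne : ∀ p : Σ t : F, QuadRoots t, p.2.1 ≠ 0 := by
    rintro ⟨t, a, ha⟩ (h0 : a = 0)
    simp [h0] at ha
  refine Nat.card_eq_of_bijective (fun p => Units.mk0 p.2.1 (hne p)) ⟨?_, fun u => ?_⟩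
  · rintro ⟨t, a, ha⟩ ⟨t', a', ha'⟩ h
    obtain rfl : a = a' := congrArg Units.val h
    obtain rfl : t = t' := by
      refine mul_right_cancel₀ (hne ⟨t, a, ha⟩) ?_
      change t * a = t' * a
      linear_combination ha - ha'
    rfl
  · have := u.ne_zero
    refine ⟨⟨-(u ^ 2 + 1) / u, u, ?_⟩, Units.ext rfl⟩
    field_simp
    ring

theorem card_quadRoots_zero [CharP F 2] : Nat.card (QuadRoots (0 : F)) = 1 := by
  rw [Nat.card_eq_one_iff_unique]
  have h2 : (2 : F) = 0 := CharTwo.two_eq_zero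
  refine ⟨⟨?_⟩, ⟨1, by linear_combination h2⟩⟩
  rintro ⟨a, ha⟩ ⟨b, hb⟩
  rw [Subtype.mk.injEq, ← sub_eq_zero, ← sq_eq_zero_iff]
  linear_combination ha - hb + (b ^ 2 - a * b) * h2

/-- If a is a root, the other one is a + t, distinct because t ≠ 0. -/
theorem card_quadRoots_eq_zero_or_two [CharP F 2] {t : F} (ht : t ≠ 0) :
    Nat.card (QuadRoots t) = 0 ∨ Nat.card (QuadRoots t) = 2 := by
  have h2 : (2 : F) = 0 := CharTwo.two_eq_zero
  by_cases h : IsEmpty (QuadRoots t)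
  · exact Or.inl Nat.card_of_isEmpty
  · obtain ⟨a, ha⟩ := not_isEmpty_iff.mp h
    refine Or.inr (Nat.card_eq_two_iff.mpr
      ⟨⟨a, ha⟩, ⟨a + t, by linear_combination ha + (a * t + t ^ 2) * h2⟩, ?_, ?_⟩)
    · simpa using ht
    · rw [Set.eq_univ_iff_forall]
      rintro ⟨b, hb⟩
      have : (b - a) * (b - (a + t)) = 0 := by
        linear_combination hb - ha + (a ^ 2 + a * t - a * b - b * t) * h2
      simp only [Set.mem_insert_iff, Set.mem_singleton_iff, Subtype.mk.injEq]
      rcases mul_eq_zero.mp this with h | h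
      · exact Or.inl (sub_eq_zero.mp h)
      · exact Or.inr (sub_eq_zero.mp h)

theorem sum_comp_card_quadRoots [Fintype F] [CharP F 2] (h : ℕ → ℝ) :
    ∑ t : F, h (Nat.card (QuadRoots t)) =
      h 1 + Nat.card F / 2 * h 0 + (Nat.card F - 2) / 2 * h 2 := by
  classical
  -- On the values 0 and 2, `h` agrees with its linear interpolation, so only the sum of the root
  -- counts is needed; the indicator term corrects the value 1 at t = 0.
  have key : ∀ t : F, h (Nat.card (QuadRoots t)) =
      (if t = 0 then h 1 - h 0 - (h 2 - h 0) / 2 else 0) +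
        (h 0 + Nat.card (QuadRoots t) * ((h 2 - h 0) / 2)) := by
    intro t
    by_cases ht : t = 0
    · subst ht
      rw [card_quadRoots_zero, if_pos rfl]
      push_cast
      ring
    · rw [if_neg ht]
      rcases card_quadRoots_eq_zero_or_two ht with h' | h' <;> rw [h'] <;> push_cast <;> ring
  have hsum : ∑ t : F, (Nat.card (QuadRoots t) : ℝ) = Nat.card F - 1 := by
    rw [← Nat.cast_sum, sum_card_quadRoots, Nat.cast_sub Nat.card_pos, Nat.cast_one]
  rw [Finset.sum_congr rfl fun t _ => key t, Finset.sum_add_distrib, Finset.sum_add_distrib,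
    ← Finset.sum_mul, hsum, Finset.sum_ite_eq' Finset.univ (0 : F), Finset.sum_const,
    Finset.card_univ, ← Nat.card_eq_fintype_card]
  simp only [Finset.mem_univ, if_true, nsmul_eq_mul]
  ring

end CharTwo

/-! ### Centralizers and trace classes in SL(2,F). -/

namespace Matrix.SpecialLinearGroup

variable {F : Type*} [Field F]

theorem exists_eq_smul_one_add_smul_of_commute {g h : Matrix (Fin 2) (Fin 2) F}
    (hg : ∀ x : F, g ≠ x • 1) (hc : h * g = g * h) : ∃ x y : F, h = x • 1 + y • g := by
  have e00 := congrFun (congrFun hc 0) 0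
  have e01 := congrFun (congrFun hc 0) 1
  have e10 := congrFun (congrFun hc 1) 0
  simp only [mul_apply, Fin.sum_univ_two] at e00 e01 e10
  -- Modulo scalars a 2×2 matrix is the vector (off-diagonal entries, diagonal difference).
  -- Commuting makes the vectors of `h` and `g` parallel, and that of `g` is nonzero; the cases
  -- divide by one of its nonzero coordinates.
  suffices H : ∃ y : F, h 0 1 = y * g 0 1 ∧ h 1 0 = y * g 1 0 ∧
      h 0 0 - h 1 1 = y * (g 0 0 - g 1 1) by
    obtain ⟨y, h1, h2, h3⟩ := H
    refine ⟨h 0 0 - y * g 0 0, y, ?_⟩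
    ext i j
    fin_cases i <;> fin_cases j
    · simp
    · simp [h1]
    · simp [h2]
    · simp
      linear_combination -h3
  by_cases hb : g 0 1 = 0
  · by_cases hcc : g 1 0 = 0
    · by_cases hd : g 0 0 - g 1 1 = 0
      · refine absurd ?_ (hg (g 0 0))
        ext i j
        fin_cases i <;> fin_cases j
        · simp
        · simp [hb]
        · simp [hcc]
        · simpa using (sub_eq_zero.mp hd).symm
      · refine ⟨(h 0 0 - h 1 1) / (g 0 0 - g 1 1), ?_, ?_, ?_⟩
        · rw [hb] at e01 ⊢
          rw [mul_zero]
          refine (mul_eq_zero.mp (?_ : (g 0 0 - g 1 1) * h 0 1 = 0)).resolve_left hd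
          linear_combination -e01
        · rw [hcc] at e10 ⊢
          rw [mul_zero]
          refine (mul_eq_zero.mp (?_ : (g 0 0 - g 1 1) * h 1 0 = 0)).resolve_left hd
          linear_combination e10
        · field_simp
    · refine ⟨h 1 0 / g 1 0, ?_, ?_, ?_⟩
      · field_simp
        linear_combination e00
      · field_simp
      · field_simp
        linear_combination -e10
  · refine ⟨h 0 1 / g 0 1, ?_, ?_, ?_⟩
    · field_simp
    · field_simp
      linear_combination -e00
    · field_simp
      linear_combination e01

theorem eq_one_of_coe_eq_smul_one [CharP F 2] {g : SpecialLinearGroup (Fin 2) F} {x : F}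
    (h : (g : Matrix (Fin 2) (Fin 2) F) = x • 1) : g = 1 := by
  have hdet := g.det_coe
  rw [h, det_smul, det_one, Fintype.card_fin, mul_one] at hdet
  have hx : x = 1 := by
    rw [← sub_eq_zero, ← sq_eq_zero_iff]
    linear_combination hdet + (1 - x) * (CharTwo.two_eq_zero : (2 : F) = 0)
  refine Subtype.ext ?_
  rw [h, hx, one_smul, coe_one]

theorem center_eq_bot_of_charP_two [CharP F 2] :
    Subgroup.center (SpecialLinearGroup (Fin 2) F) = ⊥ := by
  rw [eq_bot_iff]
  intro g hg
  obtain ⟨r, -, hr⟩ := mem_center_iff.mp hg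
  rw [Subgroup.mem_bot]
  refine eq_one_of_coe_eq_smul_one (x := r) ?_
  rw [← hr, scalar_apply, smul_one_eq_diagonal]

theorem commute_trans_of_charP_two [CharP F 2] {u v w : SpecialLinearGroup (Fin 2) F}
    (hv : v ≠ 1) (huv : u * v = v * u) (hvw : v * w = w * v) : u * w = w * u := by
  have hv' : ∀ x : F, (v : Matrix (Fin 2) (Fin 2) F) ≠ x • 1 :=
    fun x hx => hv (eq_one_of_coe_eq_smul_one hx)
  obtain ⟨x, y, hu⟩ := exists_eq_smul_one_add_smul_of_commute hv'
    (by simpa using congrArg Subtype.val huv : (u : Matrix (Fin 2) (Fin 2) F) * v = v * u)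
  obtain ⟨x', y', hw⟩ := exists_eq_smul_one_add_smul_of_commute hv'
    (by simpa using (congrArg Subtype.val hvw).symm : (w : Matrix (Fin 2) (Fin 2) F) * v = v * w)
  refine Subtype.ext ?_
  rw [coe_mul, coe_mul, hu, hw]
  simp only [add_mul, mul_add, smul_mul_smul_comm, one_mul, mul_one, mul_comm x', mul_comm y']
  abel

theorem card_commuting_eq_card_quadConic [CharP F 2] {g : SpecialLinearGroup (Fin 2) F}
    (hg : g ≠ 1) :
    Nat.card {h : SpecialLinearGroup (Fin 2) F // h * g = g * h} =
      Nat.card (QuadConic (trace (g : Matrix (Fin 2) (Fin 2) F))) := by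
  have hg' : ∀ x : F, (g : Matrix (Fin 2) (Fin 2) F) ≠ x • 1 :=
    fun x hx => hg (eq_one_of_coe_eq_smul_one hx)
  have hdet : ∀ x y : F, det (x • 1 + y • (g : Matrix (Fin 2) (Fin 2) F)) =
      x ^ 2 + trace (g : Matrix (Fin 2) (Fin 2) F) * x * y + y ^ 2 := by
    intro x y
    have h1 := g.det_coe
    rw [det_fin_two] at h1
    rw [det_fin_two, trace_fin_two]
    simp only [add_apply, smul_apply, smul_eq_mul, one_apply_eq, ne_eq, zero_ne_one,
      not_false_eq_true, one_apply_ne, one_ne_zero]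
    linear_combination y ^ 2 * h1
  symm
  refine Nat.card_eq_of_bijective
    (fun p => ⟨⟨p.1.1 • 1 + p.1.2 • (g : Matrix (Fin 2) (Fin 2) F), by rw [hdet, p.2]⟩,
      Subtype.ext (by
        change (p.1.1 • 1 + p.1.2 • (g : Matrix (Fin 2) (Fin 2) F)) * (g : Matrix (Fin 2) (Fin 2) F) =
          (g : Matrix (Fin 2) (Fin 2) F) * (p.1.1 • 1 + p.1.2 • (g : Matrix (Fin 2) (Fin 2) F))
        simp [add_mul, mul_add])⟩) ⟨?_, ?_⟩
  · rintro ⟨⟨x, y⟩, hp⟩ ⟨⟨x', y'⟩, hp'⟩ h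
    have hM : x • 1 + y • (g : Matrix (Fin 2) (Fin 2) F) = x' • 1 + y' • (g : Matrix _ _ F) :=
      congrArg (fun z => z.1.1) h
    have hy : y = y' := by
      by_contra hne
      have hne' : y - y' ≠ 0 := sub_ne_zero.mpr hne
      refine hg' ((x' - x) / (y - y')) ?_
      have : (y - y') • (g : Matrix (Fin 2) (Fin 2) F) = (x' - x) • 1 := by
        rw [sub_smul, sub_smul, sub_eq_sub_iff_add_eq_add, add_comm, hM]
      rw [div_eq_inv_mul, mul_smul, ← this, smul_smul, inv_mul_cancel₀ hne', one_smul]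
    subst hy
    have hx : x = x' := by
      simpa using congrFun (congrFun hM 0) 0
    subst hx
    rfl
  · rintro ⟨h, hc⟩
    obtain ⟨x, y, hxy⟩ := exists_eq_smul_one_add_smul_of_commute hg'
      (by simpa using congrArg Subtype.val hc : (h : Matrix (Fin 2) (Fin 2) F) * g = g * h)
    refine ⟨⟨(x, y), ?_⟩, Subtype.ext (Subtype.ext hxy.symm)⟩
    rw [← hdet, ← hxy, det_coe]

/-- With top row (a, b) and trace t, determinant 1 reads bc = a² + ta + 1. If b ≠ 0, c is determined
by a and b; if b = 0, a is a root and c is free. -/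
theorem card_trace_eq [Finite F] [CharP F 2] (t : F) :
    Nat.card {g : SpecialLinearGroup (Fin 2) F // trace (g : Matrix (Fin 2) (Fin 2) F) = t} =
      Nat.card F * (Nat.card F - 1) + Nat.card (QuadRoots t) * Nat.card F := by
  have h2 : (2 : F) = 0 := CharTwo.two_eq_zero
  let f : (F × Fˣ) ⊕ (QuadRoots t × F) →
      {g : SpecialLinearGroup (Fin 2) F // trace (g : Matrix (Fin 2) (Fin 2) F) = t} :=
    Sum.elim
      (fun p => ⟨⟨!![p.1, p.2; (p.1 ^ 2 + t * p.1 + 1) / p.2, t - p.1], by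
        have := p.2.ne_zero
        rw [det_fin_two_of]
        field_simp
        linear_combination (-p.1 ^ 2 - 1) * h2⟩, by simp [trace_fin_two]⟩)
      (fun p => ⟨⟨!![p.1.1, 0; p.2, t - p.1.1], by
        rw [det_fin_two_of]
        linear_combination p.1.2 - (p.1.1 ^ 2 + 1) * h2⟩, by simp [trace_fin_two]⟩)
  have hent : ∀ p q, f p = f q → ∀ i j, (f p).1.1 i j = (f q).1.1 i j := fun p q h i j => by rw [h]
  rw [← Nat.card_units, ← Nat.card_prod, ← Nat.card_prod, ← Nat.card_sum]
  symm
  refine Nat.card_eq_of_bijective f ⟨?_, ?_⟩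
  · rintro (⟨a, b⟩ | ⟨a, c⟩) (⟨a', b'⟩ | ⟨a', c'⟩) h
    · have h0 := hent _ _ h 0 0
      have h1 := hent _ _ h 0 1
      obtain rfl : a = a' := by simpa [f] using h0
      obtain rfl : b = b' := Units.ext (by simpa [f] using h1)
      rfl
    · have h1 := hent _ _ h 0 1
      simp [f] at h1
    · have h1 := hent _ _ h 0 1
      exact absurd (by simpa [f] using h1.symm) b'.ne_zero
    · have h0 := hent _ _ h 0 0
      have h1 := hent _ _ h 1 0
      obtain rfl : a = a' := Subtype.ext (by simpa [f] using h0)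
      obtain rfl : c = c' := by simpa [f] using h1
      rfl
  · rintro ⟨g, hg⟩
    have hdet := g.det_coe
    rw [det_fin_two] at hdet
    rw [trace_fin_two] at hg
    have h11 : g.1 1 1 = t - g.1 0 0 := by linear_combination hg
    rw [h11] at hdet
    by_cases hb : g.1 0 1 = 0
    · refine ⟨Sum.inr (⟨g.1 0 0, ?_⟩, g.1 1 0), ?_⟩
      · rw [hb] at hdet
        linear_combination hdet + (g.1 0 0 ^ 2 + 1) * h2
      · refine Subtype.ext (Subtype.ext ?_)
        ext i j
        fin_cases i <;> fin_cases j <;> simp [f, hb, h11]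
    · refine ⟨Sum.inl (g.1 0 0, Units.mk0 (g.1 0 1) hb), ?_⟩
      refine Subtype.ext (Subtype.ext ?_)
      ext i j
      fin_cases i <;> fin_cases j
      · simp [f]
      · simp [f]
      · simp only [f]
        simp
        field_simp
        linear_combination hdet + (g.1 0 0 ^ 2 + 1) * h2
      · simp [f, h11]

end Matrix.SpecialLinearGroup

/-! ### Degrees in the commuting graph. -/

section CommutingGraph

open Matrix SimpleGraph

variable {F : Type*} [Field F] {G : Type*} [Group G]

theorem mem_center_iff_of_mulEquiv [CharP F 2] (e : G ≃* SpecialLinearGroup (Fin 2) F) (x : G) :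
    x ∈ Subgroup.center G ↔ e x = 1 := by
  rw [← Subgroup.mem_bot, ← SpecialLinearGroup.center_eq_bot_of_charP_two, Subgroup.mem_center_iff,
    Subgroup.mem_center_iff, e.surjective.forall]
  simp only [← map_mul, e.injective.eq_iff]

theorem commutingGraph_adj_trans_of_mulEquiv [CharP F 2] (e : G ≃* SpecialLinearGroup (Fin 2) F)
    (u v w : NonCentral G) (huv : (commutingGraph G).Adj u v) (hvw : (commutingGraph G).Adj v w)
    (huw : u ≠ w) : (commutingGraph G).Adj u w := by
  refine ⟨huw, e.injective ?_⟩
  rw [map_mul, map_mul]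
  refine SpecialLinearGroup.commute_trans_of_charP_two (v := e v.1)
    (fun h => v.2 ((mem_center_iff_of_mulEquiv e _).mpr h)) ?_ ?_
  · rw [← map_mul, ← map_mul, huv.2]
  · rw [← map_mul, ← map_mul, hvw.2]

/-- The 2 accounts for the identity, which is not a vertex, and for `v` itself. -/
theorem commutingGraph_degree_add_two [Finite G] [Fintype (NonCentral G)] [DecidableEq (NonCentral G)]
    [DecidableRel (commutingGraph G).Adj] (hZ : Subgroup.center G = ⊥) (v : NonCentral G) :
    (commutingGraph G).degree v + 2 = Nat.card {h : G // h * v = v * h} := by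
  have hv1 : (v : G) ≠ 1 := fun h => v.2 (h ▸ one_mem _)
  have hZ' : ∀ x : G, x ∈ Subgroup.center G ↔ x = 1 := fun x => by rw [hZ, Subgroup.mem_bot]
  let f : Option (Option {w // (commutingGraph G).Adj v w}) → {h : G // h * v = v * h}
    | none => ⟨1, by simp⟩
    | some none => ⟨v, rfl⟩
    | some (some w) => ⟨w.1.1, w.2.2.symm⟩
  have hf : Function.Bijective f := by
    constructor
    · rintro (_ | _ | w) (_ | _ | w') h <;> simp only [f, Subtype.mk.injEq] at h
      · rfl
      · exact absurd h.symm hv1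
      · exact absurd ((hZ' _).mpr h.symm) w'.1.2
      · exact absurd h hv1
      · rfl
      · exact absurd (Subtype.ext h) w'.2.1
      · exact absurd ((hZ' _).mpr h) w.1.2
      · exact absurd (Subtype.ext h.symm) w.2.1
      · obtain rfl : w = w' := Subtype.ext (Subtype.ext h)
        rfl
    · rintro ⟨h, hh⟩
      by_cases h1 : h = 1
      · exact ⟨none, Subtype.ext h1.symm⟩
      by_cases h2 : h = v
      · exact ⟨some none, Subtype.ext h2.symm⟩
      · exact ⟨some (some ⟨⟨h, fun hc => h1 ((hZ' h).mp hc)⟩,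
          fun hc => h2 (congrArg Subtype.val hc).symm, hh.symm⟩), rfl⟩
  rw [← Nat.card_eq_of_bijective f hf, Finite.card_option, Finite.card_option,
    Nat.card_eq_fintype_card, Fintype.card_subtype, ← neighborFinset_eq_filter,
    card_neighborFinset_eq_degree]

theorem nonempty_mulEquiv_projectiveSpecialLinearGroup [CharP F 2] :
    Nonempty (ProjectiveSpecialLinearGroup (Fin 2) F ≃* SpecialLinearGroup (Fin 2) F) :=
  ⟨(QuotientGroup.quotientMulEquivOfEq SpecialLinearGroup.center_eq_bot_of_charP_two).trans
    QuotientGroup.quotientBot⟩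

variable [Fintype F] [Finite G] [Fintype (NonCentral G)] [DecidableEq (NonCentral G)]
  [DecidableRel (commutingGraph G).Adj]

theorem commutingGraph_degree_of_mulEquiv [CharP F 2] (e : G ≃* SpecialLinearGroup (Fin 2) F)
    (v : NonCentral G) :
    ((commutingGraph G).degree v : ℝ) =
      Nat.card F - 1 - Nat.card (QuadRoots (trace (e v : Matrix (Fin 2) (Fin 2) F))) := by
  have hZ : Subgroup.center G = ⊥ := by
    ext x
    rw [mem_center_iff_of_mulEquiv e, Subgroup.mem_bot, EmbeddingLike.map_eq_one_iff]
  have h1 := commutingGraph_degree_add_two hZ v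
  have h2 : Nat.card {h : G // h * v = v * h} =
      Nat.card {h : SpecialLinearGroup (Fin 2) F // h * e v = e v * h} :=
    Nat.card_congr (e.toEquiv.subtypeEquiv fun h => by
      change _ ↔ e h * e v = e v * e h
      rw [← map_mul, ← map_mul, e.injective.eq_iff])
  have h3 := SpecialLinearGroup.card_commuting_eq_card_quadConic
    (fun h => v.2 ((mem_center_iff_of_mulEquiv e _).mpr h))
  have h4 := card_quadConic_add_card_quadRoots (trace (e v : Matrix (Fin 2) (Fin 2) F))
  have h5 : (commutingGraph G).degree v + 2 +
      Nat.card (QuadRoots (trace (e v : Matrix (Fin 2) (Fin 2) F))) = Nat.card F + 1 := by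
    rw [h1, h2, h3, h4]
  have h6 := congrArg (Nat.cast (R := ℝ)) h5
  push_cast at h6
  linarith

theorem sum_comp_degree_commutingGraph_of_mulEquiv [CharP F 2]
    (e : G ≃* SpecialLinearGroup (Fin 2) F) (f : ℝ → ℝ) {q : ℝ} (hq : Nat.card F = q) :
    ∑ v, f ((commutingGraph G).degree v) =
      (q ^ 2 - 1) * f (q - 2) + q ^ 2 * (q - 1) / 2 * f (q - 1) +
        q * (q + 1) * (q - 2) / 2 * f (q - 3) := by
  classical
  let ψ : F → ℝ := fun t => f (q - 1 - Nat.card (QuadRoots t))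
  let tr : SpecialLinearGroup (Fin 2) F → F := fun g => trace (g : Matrix (Fin 2) (Fin 2) F)
  have hne : ∀ x : G, x ∉ Subgroup.center G ↔ e x ≠ 1 :=
    fun x => (mem_center_iff_of_mulEquiv e x).not
  have h1 : ∑ v, f ((commutingGraph G).degree v) =
      ∑ g : {g : SpecialLinearGroup (Fin 2) F // g ≠ 1}, ψ (tr g) :=
    Fintype.sum_equiv (e.toEquiv.subtypeEquiv hne) _ _ fun v => by
      rw [commutingGraph_degree_of_mulEquiv e, hq]
      rfl
  have htr1 : tr 1 = 0 := by
    simp [tr, CharTwo.two_eq_zero]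
  -- The identity has trace 0, so it is removed from the class of degree q - 2, leaving q² - 1
  -- vertices there.
  have h2 : ∑ g : {g : SpecialLinearGroup (Fin 2) F // g ≠ 1}, ψ (tr g) =
      ∑ g, ψ (tr g) - f (q - 2) := by
    rw [Finset.sum_subtype (Finset.univ.erase 1) (by simp) (fun g => ψ (tr g)) |>.symm,
      ← Finset.add_sum_erase Finset.univ (fun g => ψ (tr g)) (Finset.mem_univ 1)]
    simp only [htr1, ψ, card_quadRoots_zero]
    push_cast
    rw [show q - 1 - 1 = q - 2 by ring]
    ring
  have h3 : ∑ g, ψ (tr g) = ∑ t : F,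
      (fun r : ℕ => (q * (q - 1) + r * q) * f (q - 1 - r)) (Nat.card (QuadRoots t)) := by
    rw [← Finset.sum_fiberwise Finset.univ tr]
    refine Finset.sum_congr rfl fun t _ => ?_
    have hcard := SpecialLinearGroup.card_trace_eq t
    rw [Nat.card_eq_fintype_card, Fintype.card_subtype] at hcard
    rw [Finset.sum_congr rfl (g := fun _ => ψ t) fun g hg => by rw [(Finset.mem_filter.mp hg).2],
      Finset.sum_const, hcard, nsmul_eq_mul]
    push_cast [Nat.cast_sub (Nat.card_pos (α := F))]
    rw [hq]
  rw [h1, h2, h3, sum_comp_card_quadRoots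
    (fun r : ℕ => (q * (q - 1) + r * q) * f (q - 1 - r)), hq]
  push_cast
  rw [show q - 1 - 1 = q - 2 by ring, show q - 1 - 2 = q - 3 by ring, sub_zero]
  ring

theorem averageDeg_commutingGraph_of_mulEquiv [CharP F 2]
    (e : G ≃* SpecialLinearGroup (Fin 2) F) {q : ℝ} (hq : Nat.card F = q) :
    (commutingGraph G).averageDeg =
      (q ^ 4 - 2 * q ^ 3 - q ^ 2 + 2 * q + 2) / (q ^ 3 - q - 1) := by
  have h1 := sum_comp_degree_commutingGraph_of_mulEquiv e (fun _ => 1) hq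
  rw [Finset.sum_const, Finset.card_univ, nsmul_eq_mul, mul_one] at h1
  rw [averageDeg_eq_sum_div, h1, sum_comp_degree_commutingGraph_of_mulEquiv e (fun x => x) hq]
  congr 1 <;> ring

end CommutingGraph

/-! ### Evaluation of the three energies. -/

theorem mainTheorem4 (k : ℕ) (hk : 2 ≤ k) (F : Type*) [Field F] [Fintype F]
    (hF : Fintype.card F = 2 ^ k)
    [Fintype (NonCentral (Matrix.ProjectiveSpecialLinearGroup (Fin 2) F))]
    [DecidableEq (NonCentral (Matrix.ProjectiveSpecialLinearGroup (Fin 2) F))]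
    [DecidableRel (commutingGraph (Matrix.ProjectiveSpecialLinearGroup (Fin 2) F)).Adj] :
    (commutingGraph (Matrix.ProjectiveSpecialLinearGroup (Fin 2) F)).energy =
      (2 : ℝ) ^ (3 * k + 1) - 2 ^ (2 * k + 1) - 2 ^ (k + 2) - 4 ∧
    (commutingGraph (Matrix.ProjectiveSpecialLinearGroup (Fin 2) F)).lapEnergy =
      ((2 : ℝ) * 2 ^ (6 * k) - 2 * 2 ^ (5 * k) - 3 * 2 ^ (4 * k) - 4 * 2 ^ (3 * k)
        + 3 * 2 ^ (2 * k) + 8 * 2 ^ k + 4) / (2 ^ (3 * k) - 2 ^ k - 1) ∧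
    (commutingGraph (Matrix.ProjectiveSpecialLinearGroup (Fin 2) F)).signlessLapEnergy =
      if k = 2 then
        ((2 : ℝ) ^ (6 * k) + 2 ^ (5 * k) - 3 * 2 ^ (4 * k) - 7 * 2 ^ (3 * k)
          + 4 * 2 ^ k + 4) / (2 ^ (3 * k) - 2 ^ k - 1)
      else
        ((2 : ℝ) * 2 ^ (6 * k) - 2 * 2 ^ (5 * k) - 8 * 2 ^ (4 * k) - 6 * 2 ^ (3 * k)
          + 6 * 2 ^ (2 * k) + 8 * 2 ^ k + 4) / (2 ^ (3 * k) - 2 ^ k - 1) := by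
  have : CharP F 2 := charP_of_card_eq_prime_pow hF
  obtain ⟨e⟩ := nonempty_mulEquiv_projectiveSpecialLinearGroup (F := F)
  have : Finite (Matrix.ProjectiveSpecialLinearGroup (Fin 2) F) := Finite.of_equiv _ e.toEquiv.symm
  obtain ⟨q, hq⟩ : ∃ q : ℝ, q = 2 ^ k := ⟨_, rfl⟩
  have hcard : (Nat.card F : ℝ) = q := by
    rw [Nat.card_eq_fintype_card, hF, hq]
    push_cast
    rfl
  have hpow : ∀ n, (2 : ℝ) ^ (n * k) = q ^ n := fun n => by rw [hq, ← pow_mul, mul_comm]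
  have hq4 : 4 ≤ q := by
    rw [hq]
    calc (4 : ℝ) = 2 ^ 2 := by norm_num
      _ ≤ 2 ^ k := pow_le_pow_right₀ (by norm_num) hk
  have hN : 0 < q ^ 3 - q - 1 := by nlinarith [mul_pos (show 0 < q by linarith) (show 0 < q by linarith)]
  -- The average degree is q - 2 + d with 0 < d < 1, which settles the sign inside every absolute
  -- value except one in the signless case.
  obtain ⟨d, hd⟩ : ∃ d, d = q / (q ^ 3 - q - 1) := ⟨_, rfl⟩
  have hdN : d * (q ^ 3 - q - 1) = q := by rw [hd, div_mul_cancel₀ _ hN.ne']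
  have hd0 : 0 < d := by rw [hd]; positivity
  have hd1 : d < 1 := by
    rw [hd, div_lt_one hN]
    nlinarith [mul_pos (show 0 < q by linarith) (show 0 < q by linarith)]
  have havg : (commutingGraph (Matrix.ProjectiveSpecialLinearGroup (Fin 2) F)).averageDeg =
      q - 2 + d := by
    rw [averageDeg_commutingGraph_of_mulEquiv e hcard, div_eq_iff hN.ne']
    linear_combination -hdN
  have htrans := commutingGraph_adj_trans_of_mulEquiv e
  have n1 : q - 1 ≠ 0 := by linarith
  have n2 : q - 2 ≠ 0 := by linarith
  have n0 : q ≠ 0 := by linarith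
  refine ⟨?_, ?_, ?_⟩
  · rw [SimpleGraph.energy_eq_sum_of_adj_trans htrans,
      sum_comp_degree_commutingGraph_of_mulEquiv e (fun x => 2 * x / (x + 1)) hcard,
      pow_add, pow_add, pow_add, hpow, hpow, ← hq,
      show q - 2 + 1 = q - 1 by ring, show q - 1 + 1 = q by ring, show q - 3 + 1 = q - 2 by ring]
    field_simp
    ring
  · rw [SimpleGraph.lapEnergy_eq_sum_of_adj_trans htrans, havg,
      sum_comp_degree_commutingGraph_of_mulEquiv e
        (fun x => (|q - 2 + d| + x * |x + 1 - (q - 2 + d)|) / (x + 1)) hcard]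
    simp only [hpow, ← hq]
    rw [show q - 2 + 1 = q - 1 by ring, show q - 1 + 1 = q by ring,
      show q - 3 + 1 = q - 2 by ring,
      abs_of_pos (show 0 < q - 2 + d by linarith),
      abs_of_pos (show 0 < q - 1 - (q - 2 + d) by linarith),
      abs_of_pos (show 0 < q - (q - 2 + d) by linarith),
      abs_of_neg (show q - 2 - (q - 2 + d) < 0 by linarith)]
    -- With the signs fixed, the sum is a polynomial in q plus a polynomial multiple of d; `hdN`
    -- then eliminates d.
    refine Eq.trans (b := (q + 1) * (q - 2 + (q - 2)) + q * (q - 1) / 2 * (q - 2 + (q - 1) * 2) +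
      q * (q + 1) / 2 * (q - 2) + 3 * d) (by field_simp; ring) ?_
    rw [eq_div_iff hN.ne']
    linear_combination 3 * hdN
  · rw [SimpleGraph.signlessLapEnergy_eq_sum_of_adj_trans htrans, havg,
      sum_comp_degree_commutingGraph_of_mulEquiv e
        (fun x => (|2 * x - (q - 2 + d)| + x * |x - 1 - (q - 2 + d)|) / (x + 1)) hcard]
    simp only [hpow, ← hq]
    rw [show q - 2 + 1 = q - 1 by ring, show q - 1 + 1 = q by ring, show q - 3 + 1 = q - 2 by ring,
      abs_of_pos (show 0 < 2 * (q - 2) - (q - 2 + d) by linarith),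
      abs_of_pos (show 0 < 2 * (q - 1) - (q - 2 + d) by linarith),
      abs_of_neg (show q - 2 - 1 - (q - 2 + d) < 0 by linarith),
      abs_of_neg (show q - 1 - 1 - (q - 2 + d) < 0 by linarith),
      abs_of_neg (show q - 3 - 1 - (q - 2 + d) < 0 by linarith)]
    -- The remaining sign is that of 2(q - 3) - (q - 2 + d) = q - 4 - d: negative for q = 4,
    -- positive for q ≥ 8. This is why k = 2 is exceptional.
    split_ifs with hk2
    · have hq' : q = 4 := by rw [hq, hk2]; norm_num
      subst hq'
      rw [hd]
      norm_num [abs_of_neg, abs_of_pos]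
    · have hq8 : 8 ≤ q := by
        rw [hq]
        calc (8 : ℝ) = 2 ^ 3 := by norm_num
          _ ≤ 2 ^ k := pow_le_pow_right₀ (by norm_num) (by omega)
      rw [abs_of_pos (show 0 < 2 * (q - 3) - (q - 2 + d) by linarith)]
      refine Eq.trans (b := 2 * (q + 1) * (q - 2) + q * (q + 1) / 2 * (3 * q - 10) +
        q * (q - 1) / 2 * q + (q ^ 3 - 2 * q ^ 2 - 3 * q - 3) * d) (by field_simp; ring) ?_
      rw [eq_div_iff hN.ne']
      linear_combination (q ^ 3 - 2 * q ^ 2 - 3 * q - 3) * hdN
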